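/- Let $c,r,\mu,\sigma,\sigma_1,\lambda,m>0$ and $|\rho|<1$ be constants with $\mu\neq r$, and let $F$ be the exponential distribution with mean $m$. They describe an insurer with premium rate $c$, claims arriving at rate $\lambda$ with distribution $F$, Brownian perturbation of volatility $\sigma_1$, interest rate $r$, and a stock with return $\mu$ and volatility $\sigma$, where $\rho$ is the correlation of the two Brownian motions and any amount $a\in\mathbb R$ may be invested in the stock. For $a\in\mathbb R$ put $$\mathcal L^{(a)}V(x)=\tfrac12(\sigma^2a^2+2\rho\sigma\sigma_1a+\sigma_1^2)V''(x)+[c+(\mu-r)a+rx]V'(x)-\lambda\Big[V(x)-\int_0^xV(x-s)\,dF(s)\Big].$$ The Hamilton–Jacobi–Bellman equation of ruin probability minimization, $\sup_{a\in\mathbb R}\mathcal L^{(a)}V(x)=0$ for $x>0$, has a solution $V$, continuous on $[0,\infty)$ and twice continuously differentiable on $(0,\infty)$, with $V'>0$ and $V''<0$ on $(0,\infty)$, $V(0)=0$ and $V'(0+)=1$. For every such $V$ and every $x>0$ the unique maximizer of $a\mapsto\mathcal L^{(a)}V(x)$, called the optimal investment at surplus $x$, is $$a^*_V(x)=-\frac{(\mu-r)V'(x)}{\sigma^2V''(x)}-\rho\frac{\sigma_1}{\sigma},$$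 and, as $x\to\infty$, $$a^*_V(x)=\frac{(\mu-r)m}{\sigma^2}-\rho\frac{\sigma_1}{\sigma}-\Big(1-\frac{\lambda}{r}\Big)\frac{(\mu-r)m^2}{\sigma^2}\,\frac1x+o\Big(\frac1x\Big).$$ In particular $a^*_V(x)$ tends to the finite limit $\frac{(\mu-r)m}{\sigma^2}-\rho\frac{\sigma_1}{\sigma}$, and if $\lambda\neq r$ then $$a^*_V(x)=\frac{(\mu-r)m}{\sigma^2}-\rho\frac{\sigma_1}{\sigma}-\Big(1-\frac{\lambda}{r}\Big)\frac{(\mu-r)m^2}{\sigma^2}\,\frac1x\,(1+o(1)).$$ -/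

import Mathlib

open Set Filter Topology Asymptotics MeasureTheory

noncomputable section

/-- Coefficients of the perturbed Cramér–Lundberg surplus with investment: premium rate `c`,
interest rate `r`, stock return `μ`, stock volatility `σ`, perturbation volatility `σ₁`,
correlation `ρ` of the two Brownian motions, claim intensity `lam`. -/
structure SurplusModel where
  c : ℝ
  r : ℝ
  μ : ℝ
  σ : ℝ
  σ₁ : ℝ
  ρ : ℝ
  lam : ℝ

namespace SurplusModel

/-- The jump part `M(W)(x) = λ [W(x) - ∫₀ˣ W(x - s) dF(s)]`, for a claim distribution `F`
carried by `(0, ∞)`. -/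
def jumpTerm (P : SurplusModel) (F : Measure ℝ) (W : ℝ → ℝ) (x : ℝ) : ℝ :=
  P.lam * (W x - ∫ s in Ioc 0 x, W (x - s) ∂F)

/-- The controlled generator
`L^(a) W(x) = ½(σ²a² + 2ρσσ₁a + σ₁²) W''(x) + [c + (μ - r)a + rx] W'(x) - M(W)(x)`. -/
def generator (P : SurplusModel) (F : Measure ℝ) (a : ℝ) (W : ℝ → ℝ) (x : ℝ) : ℝ :=
  (1 / 2) * (P.σ ^ 2 * a ^ 2 + 2 * P.ρ * P.σ * P.σ₁ * a + P.σ₁ ^ 2) * deriv (deriv W) x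
    + (P.c + (P.μ - P.r) * a + P.r * x) * deriv W x - P.jumpTerm F W x

/-- `W` is a classical, increasing and concave solution on `(0, ∞)` of the HJB equation
`sup_{a ∈ ℝ} L^(a) W(x) = 0` of unconstrained investment, with `W(0) = 0` and `W'(0+) = 1`. -/
structure IsHJBSolution (P : SurplusModel) (F : Measure ℝ) (W : ℝ → ℝ) : Prop where
  contDiffOn : ContDiffOn ℝ 2 W (Ioi 0)
  continuousOn : ContinuousOn W (Ici 0)
  deriv_pos : ∀ x, 0 < x → 0 < deriv W x
  deriv_deriv_neg : ∀ x, 0 < x → deriv (deriv W) x < 0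
  zero : W 0 = 0
  deriv_zero_right : Tendsto (deriv W) (𝓝[>] 0) (𝓝 1)
  hjb : ∀ x, 0 < x → IsLUB (range fun a : ℝ => P.generator F a W x) 0

/-- The optimal unconstrained investment at surplus `x`,
`a*_W(x) = -(μ - r)W'(x) / (σ²W''(x)) - ρσ₁/σ`. -/
def optimalInvestment (P : SurplusModel) (W : ℝ → ℝ) (x : ℝ) : ℝ :=
  -((P.μ - P.r) * deriv W x) / (P.σ ^ 2 * deriv (deriv W) x) - P.ρ * (P.σ₁ / P.σ)

/-- The limit `(μ - r)m/σ² - ρσ₁/σ` for exponential claims of mean `m`. -/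
def limitInvestment (P : SurplusModel) (m : ℝ) : ℝ :=
  (P.μ - P.r) * m / P.σ ^ 2 - P.ρ * (P.σ₁ / P.σ)

/-- The coefficient `(1 - λ/r)(μ - r)m²/σ²` of `-1/x` for exponential claims of mean `m`. -/
def rateCoeff (P : SurplusModel) (m : ℝ) : ℝ :=
  (1 - P.lam / P.r) * ((P.μ - P.r) * m ^ 2 / P.σ ^ 2)

end SurplusModel

end

/-! Maximizing over the investment by completing the square turns the HJB equation into `A V'' + (k
+ r x) V' - R V'^2 / V'' = M(V)`, with `A = residualVariance`, `k = hedgedPremium`, `R =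
halfSqSharpe` and `M` the jump term. Put `w = -V''/V'` and `h = M(V)/(λ V')`. Division by `V'`
leaves the quadratic `A w^2 - B w - R = 0` with `B = k + r x - λ h`, and concavity selects its
positive root. For exponential claims `exp (x/m) M(V)/λ` is a primitive of `V' exp (x/m)`, so `h' =
1 + h (w - 1/m)`: the integro-differential equation becomes a scalar ODE for `h`
(`IsHJBSolution.exists_reduced`).

Asymptotics: if `w` stayed large, `h` would outgrow `r x / λ` and push `B`, hence `w`, down; if `w`
is small, `B` increases. So `w` is eventually trapped between positive constants, `B` is bounded and
`λ h ~ r x`. Then `z = x (w - 1/m)` solves a linear relaxation equation whose moving equilibrium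
tends to `1 - λ/r` (`tendsto_mul_riccatiRoot_sub`), and `a*` is an affine function of `1/w`. Only
positivity of `h` is used, so every solution `V` is covered without a uniqueness theorem.

Existence: solve the scalar ODE with `h 0 = 0` (`exists_reduced_solution`) and integrate back, `V' =
exp (-∫ w)`. -/

/-- The positive root of `A w² - B w - R = 0`, as a function of `B`. -/
noncomputable def riccatiRoot (A R B : ℝ) : ℝ := (B + √(B ^ 2 + 4 * A * R)) / (2 * A)

/-! ### The positive root of the quadratic and its dependence on `B`. -/

section RiccatiRoot

variable {A R : ℝ}

theorem abs_lt_sqrt_discrim (hA : 0 < A) (hR : 0 < R) (B : ℝ) :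
    |B| < √(B ^ 2 + 4 * A * R) := by
  rw [← Real.sqrt_sq_eq_abs]
  exact Real.sqrt_lt_sqrt (sq_nonneg B) (by nlinarith [mul_pos hA hR])

theorem riccatiRoot_pos (hA : 0 < A) (hR : 0 < R) (B : ℝ) : 0 < riccatiRoot A R B := by
  have h := (abs_lt.1 (abs_lt_sqrt_discrim hA hR B)).1
  exact div_pos (by linarith) (by linarith)

theorem riccatiRoot_eq (hA : 0 < A) (hR : 0 < R) (B : ℝ) :
    A * riccatiRoot A R B ^ 2 - B * riccatiRoot A R B - R = 0 := by
  have h : √(B ^ 2 + 4 * A * R) ^ 2 = B ^ 2 + 4 * A * R :=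
    Real.sq_sqrt (by nlinarith [mul_pos hA hR, sq_nonneg B])
  unfold riccatiRoot
  generalize √(B ^ 2 + 4 * A * R) = s at h
  field_simp
  linear_combination h

theorem eq_of_riccatiRoot (hA : 0 < A) (hR : 0 < R) (B : ℝ) :
    B = A * riccatiRoot A R B - R / riccatiRoot A R B := by
  have h := riccatiRoot_eq hA hR B
  have hp := riccatiRoot_pos hA hR B
  field_simp
  linear_combination -h

theorem riccatiRoot_le_iff (hA : 0 < A) (hR : 0 < R) {w : ℝ} (hw : 0 < w) (B : ℝ) :
    riccatiRoot A R B ≤ w ↔ B ≤ A * w - R / w := by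
  have hp := riccatiRoot_pos hA hR B
  have he := eq_of_riccatiRoot hA hR B
  constructor
  · intro h
    rw [he]
    gcongr
  · intro h
    by_contra! hlt
    have h₁ : R / riccatiRoot A R B < R / w := div_lt_div_of_pos_left hR hw hlt
    have h₂ : A * w < A * riccatiRoot A R B := mul_lt_mul_of_pos_left hlt hA
    linarith

theorem le_riccatiRoot_iff (hA : 0 < A) (hR : 0 < R) {w : ℝ} (hw : 0 < w) (B : ℝ) :
    w ≤ riccatiRoot A R B ↔ A * w - R / w ≤ B := by
  have hp := riccatiRoot_pos hA hR B
  have he := eq_of_riccatiRoot hA hR B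
  constructor
  · intro h
    rw [he]
    gcongr
  · intro h
    by_contra! hlt
    have h₁ : R / w < R / riccatiRoot A R B := div_lt_div_of_pos_left hR hp hlt
    have h₂ : A * riccatiRoot A R B < A * w := mul_lt_mul_of_pos_left hlt hA
    linarith

theorem riccatiRoot_mono (hA : 0 < A) (hR : 0 < R) : Monotone (riccatiRoot A R) := by
  intro B₁ B₂ h
  rw [riccatiRoot_le_iff hA hR (riccatiRoot_pos hA hR B₂), ← eq_of_riccatiRoot hA hR B₂]
  exact h

theorem eq_riccatiRoot_of_root (hA : 0 < A) (hR : 0 < R) {w B : ℝ} (hw : 0 < w)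
    (h : A * w ^ 2 - B * w - R = 0) : w = riccatiRoot A R B := by
  have hB : B = A * w - R / w := by
    field_simp
    linear_combination -h
  exact le_antisymm ((le_riccatiRoot_iff hA hR hw B).2 hB.ge)
    ((riccatiRoot_le_iff hA hR hw B).2 hB.le)

/-- The derivative is the reciprocal of that of the inverse `w ↦ A w - R / w`. This form gives the
bound `1/A` at once. -/
theorem hasDerivAt_riccatiRoot (hA : 0 < A) (hR : 0 < R) (B : ℝ) :
    HasDerivAt (riccatiRoot A R)
      (A + R / riccatiRoot A R B ^ 2)⁻¹ B := by
  have hpos : 0 < B ^ 2 + 4 * A * R := by nlinarith [mul_pos hA hR, sq_nonneg B]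
  have h₁ : HasDerivAt (fun B : ℝ => B ^ 2 + 4 * A * R) (2 * B) B := by
    simpa using (hasDerivAt_pow 2 B).add_const (4 * A * R)
  have h₂ := ((hasDerivAt_id B).add (h₁.sqrt hpos.ne')).div_const (2 * A)
  refine HasDerivAt.congr_deriv (f := riccatiRoot A R) h₂ ?_
  have hs : 0 < √(B ^ 2 + 4 * A * R) := Real.sqrt_pos.2 hpos
  have hp := riccatiRoot_pos hA hR B
  have he := riccatiRoot_eq hA hR B
  have hw : riccatiRoot A R B = (B + √(B ^ 2 + 4 * A * R)) / (2 * A) := rfl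
  set s := √(B ^ 2 + 4 * A * R)
  set w := riccatiRoot A R B
  have hsw : s = 2 * A * w - B := by rw [hw]; field_simp; ring
  have hd : A * w ^ 2 + R = s * w := by rw [hsw]; linear_combination -he
  have : A + R / w ^ 2 = s / w := by field_simp; linear_combination hd
  rw [this, inv_div]
  field_simp
  rw [hsw]; ring

theorem continuous_riccatiRoot : Continuous (riccatiRoot A R) := by
  unfold riccatiRoot; fun_prop

theorem abs_riccatiRoot_sub_le (hA : 0 < A) (hR : 0 < R) (B₁ B₂ : ℝ) :
    |riccatiRoot A R B₁ - riccatiRoot A R B₂| ≤ A⁻¹ * |B₁ - B₂| := by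
  refine Convex.norm_image_sub_le_of_norm_hasDerivWithin_le (s := univ)
    (fun x _ => (hasDerivAt_riccatiRoot hA hR x).hasDerivWithinAt) (fun x _ => ?_)
    convex_univ (mem_univ B₂) (mem_univ B₁)
  have hp := riccatiRoot_pos hA hR x
  rw [Real.norm_of_nonneg (by positivity)]
  exact inv_anti₀ hA (by have : 0 ≤ R / riccatiRoot A R x ^ 2 := by positivity
                         linarith)

end RiccatiRoot

/-! ### Scalar ODE tools: global existence, barriers, relaxation. -/

/-- A scalar ODE whose right-hand side is bounded and Lipschitz in the state, uniformly on bounded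
time intervals, has a solution on all of `[0, ∞)`. -/
theorem exists_global_solution_of_bounded_lipschitz {v : ℝ → ℝ → ℝ}
    (hcont : ∀ y, Continuous fun t => v t y)
    (hlip : ∀ T : ℝ, ∃ K : NNReal, ∀ t ∈ Icc 0 T, LipschitzWith K (v t))
    (hbdd : ∀ T : ℝ, ∃ L : NNReal, ∀ t ∈ Icc 0 T, ∀ y, |v t y| ≤ L) (y₀ : ℝ) :
    ∃ g : ℝ → ℝ, g 0 = y₀ ∧ ContinuousOn g (Ici 0) ∧
      ∀ x, 0 < x → HasDerivAt g (v x (g x)) x := by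
  have hloc : ∀ n : ℕ, ∃ α : ℝ → ℝ, α 0 = y₀ ∧
      ∀ t ∈ Icc (0 : ℝ) n, HasDerivWithinAt α (v t (α t)) (Icc (0 : ℝ) n) t := by
    intro n
    obtain ⟨K, hK⟩ := hlip n
    obtain ⟨L, hL⟩ := hbdd n
    have hn : (0 : ℝ) ∈ Icc (0 : ℝ) n := ⟨le_rfl, n.cast_nonneg⟩
    -- The bound `L` holds for all states, so the ball radius `L * n` is free to cover the whole
    -- time interval.
    have hpl : IsPicardLindelof v (⟨0, hn⟩ : Icc (0 : ℝ) n) y₀ (L * n) 0 L K :=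
      { lipschitzOnWith := fun t ht => (hK t ht).lipschitzOnWith
        continuousOn := fun y _ => (hcont y).continuousOn
        norm_le := fun t ht y _ => hL t ht y
        mul_max_le := by simp }
    exact hpl.exists_eq_forall_mem_Icc_hasDerivWithinAt₀
  choose α hα₀ hα using hloc
  have hright : ∀ {n k : ℕ}, k ≤ n → ∀ t ∈ Ico (0 : ℝ) k,
      HasDerivWithinAt (α n) (v t (α n t)) (Ici t) t := by
    intro n k hkn t ht
    have htn : t < n := ht.2.trans_le (by exact_mod_cast hkn)
    refine (hα n t ⟨ht.1, htn.le⟩).mono_of_mem_nhdsWithin ?_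
    exact mem_of_superset (Icc_mem_nhdsGE htn) (Icc_subset_Icc_left ht.1)
  have hcontα : ∀ n, ContinuousOn (α n) (Icc 0 n) := fun n t ht =>
    (hα n t ht).continuousWithinAt
  have hagree : ∀ {k n : ℕ}, k ≤ n → EqOn (α k) (α n) (Icc 0 k) := by
    intro k n hkn
    obtain ⟨K, hK⟩ := hlip k
    have hkn' : (k : ℝ) ≤ n := by exact_mod_cast hkn
    exact ODE_solution_unique_of_mem_Icc_right (s := fun _ => univ)
      (fun t ht => (hK t (Ico_subset_Icc_self ht)).lipschitzOnWith)
      (hcontα k) (hright le_rfl) (fun _ _ => trivial)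
      ((hcontα n).mono (Icc_subset_Icc_right hkn')) (hright hkn) (fun _ _ => trivial)
      ((hα₀ k).trans (hα₀ n).symm)
  -- Solutions on `[0, n]` agree by uniqueness; at `x` the one with `n = ⌈x⌉₊` is taken.
  set g : ℝ → ℝ := fun x => α ⌈x⌉₊ x with hg
  have hgα : ∀ n : ℕ, EqOn g (α n) (Icc 0 n) := fun n x hx =>
    hagree (Nat.ceil_le.2 hx.2) ⟨hx.1, Nat.le_ceil x⟩
  refine ⟨g, ?_, ?_, ?_⟩
  · rw [hgα 0 (by simp), hα₀]
  · intro x hx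
    obtain ⟨n, hn⟩ := exists_nat_gt x
    have h₁ : ContinuousWithinAt g (Icc 0 n) x :=
      (hcontα n x ⟨hx, hn.le⟩).congr (hgα n) (hgα n ⟨hx, hn.le⟩)
    refine h₁.mono_of_mem_nhdsWithin ?_
    rw [← Ici_inter_Iic]
    exact inter_mem_nhdsWithin _ (Iic_mem_nhds hn)
  · intro x hx
    obtain ⟨n, hn⟩ := exists_nat_gt x
    have hmem : Icc (0 : ℝ) n ∈ 𝓝 x := Icc_mem_nhds hx hn
    have h₁ := (hα n x ⟨hx.le, hn.le⟩).hasDerivAt hmem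
    rw [hgα n ⟨hx.le, hn.le⟩]
    exact h₁.congr_of_eventuallyEq (mem_of_superset hmem (hgα n))

/-- A function which decreases at a definite rate as long as it is above `θ` ends up below `θ`. -/
theorem eventually_le_of_deriv_le_neg {f f' : ℝ → ℝ} {θ δ X : ℝ} (hδ : 0 < δ)
    (hf : ∀ x, X ≤ x → HasDerivAt f (f' x) x) (hneg : ∀ x, X ≤ x → θ ≤ f x → f' x ≤ -δ) :
    ∀ᶠ x in atTop, f x ≤ θ := by
  -- Staying above `θ` forces a linear decrease with slope `-δ`, which reaches `θ` by time `X + (f X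
  -- - θ) / δ`. Afterwards `θ` is a barrier.
  have hexit : ∃ x₁, X ≤ x₁ ∧ f x₁ ≤ θ := by
    by_contra! hcon
    have hlin : ∀ y, X ≤ y → f y ≤ f X - δ * (y - X) := by
      intro y hy
      exact image_le_of_deriv_right_le_deriv_boundary (a := X) (b := y) (f := f) (f' := f')
        (B := fun x => f X - δ * (x - X)) (B' := fun _ => -δ)
        (fun x hx => (hf x hx.1).continuousAt.continuousWithinAt)
        (fun x hx => (hf x hx.1).hasDerivWithinAt) (by simp) (by fun_prop)
        (fun x _ => by
          have := (((hasDerivAt_id x).sub_const X).const_mul δ).const_sub (f X)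
          simpa using this.hasDerivWithinAt)
        (fun x hx => hneg x hx.1 (hcon x hx.1).le) ⟨hy, le_rfl⟩
    have hd : 0 ≤ (f X - θ) / δ := div_nonneg (by linarith [hcon X le_rfl]) hδ.le
    have h₁ := hlin (X + (f X - θ) / δ) (by linarith)
    have h₂ := hcon (X + (f X - θ) / δ) (by linarith)
    rw [add_sub_cancel_left, mul_div_cancel₀ _ hδ.ne'] at h₁
    linarith
  obtain ⟨x₁, hx₁, hz₁⟩ := hexit
  filter_upwards [eventually_ge_atTop x₁] with y hy
  exact image_le_of_deriv_right_lt_deriv_boundary (a := x₁) (b := y) (f := f)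
    (f' := f') (B := fun _ => θ) (B' := fun _ => 0)
    (fun x hx => (hf x (hx₁.trans hx.1)).continuousAt.continuousWithinAt)
    (fun x hx => (hf x (hx₁.trans hx.1)).hasDerivWithinAt) hz₁
    (fun x => hasDerivAt_const x _)
    (fun x hx hEq => (hneg x (hx₁.trans hx.1) hEq.ge).trans_lt (by linarith)) ⟨hy, le_rfl⟩

/-- A solution of `z' = a (b - z)` tends to the limit of `b` if the rate `a` stays above a positive
constant. -/
theorem tendsto_of_hasDerivAt_relaxation {z a b : ℝ → ℝ} {a₀ κ : ℝ} (ha₀ : 0 < a₀)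
    (ha : ∀ᶠ x in atTop, a₀ ≤ a x) (hb : Tendsto b atTop (𝓝 κ))
    (hz : ∀ᶠ x in atTop, HasDerivAt z (a x * (b x - z x)) x) :
    Tendsto z atTop (𝓝 κ) := by
  -- The upper bound suffices: applied to `-z` and `-b` it gives the lower one. Above `κ + ε`, with
  -- `b` below `κ + ε/2`, the decrease is at least `a₀ ε / 2`.
  have key : ∀ {z b : ℝ → ℝ} {κ : ℝ}, Tendsto b atTop (𝓝 κ) →
      (∀ᶠ x in atTop, HasDerivAt z (a x * (b x - z x)) x) →
      ∀ ε > 0, ∀ᶠ x in atTop, z x ≤ κ + ε := by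
    intro z b κ hb hz ε hε
    have hb' : ∀ᶠ x in atTop, b x < κ + ε / 2 := hb.eventually_lt_const (by linarith)
    obtain ⟨X, hX⟩ := eventually_atTop.1 (ha.and (hb'.and hz))
    refine eventually_le_of_deriv_le_neg (X := X) (δ := a₀ * (ε / 2)) (by positivity)
      (fun x hx => (hX x hx).2.2) fun x hx hzx => ?_
    obtain ⟨h₁, h₂, -⟩ := hX x hx
    nlinarith [mul_le_mul h₁ (by linarith : ε / 2 ≤ z x - b x) (by linarith)
      (by linarith : 0 ≤ a x)]
  rw [Metric.tendsto_nhds]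
  intro ε hε
  have hup := key hb hz (ε / 2) (by linarith)
  have hlow := key (z := fun x => -z x) (b := fun x => -b x) hb.neg
    (hz.mono fun x hx => hx.neg.congr_deriv (by ring)) (ε / 2) (by linarith)
  filter_upwards [hup, hlow] with x h₁ h₂
  rw [Real.dist_eq, abs_lt]
  constructor <;> linarith

/-- The expected value of `V (x - S)` on `{S ≤ x}` for an exponential `S` of mean `m`. -/
theorem setIntegral_expMeasure_comp_sub {m : ℝ} (hm : 0 < m) (V : ℝ → ℝ) {x : ℝ} (hx : 0 ≤ x) :
    ∫ s in Ioc 0 x, V (x - s) ∂(ProbabilityTheory.expMeasure (1 / m)) =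
      1 / m * Real.exp (-x / m) * ∫ y in (0 : ℝ)..x, V y * Real.exp (y / m) := by
  have hmeas : Measurable (ProbabilityTheory.exponentialPDF (1 / m)) :=
    (ProbabilityTheory.measurable_exponentialPDFReal (1 / m)).ennreal_ofReal
  have h₁ : ∫ s in Ioc 0 x, V (x - s) ∂(ProbabilityTheory.expMeasure (1 / m)) =
      ∫ s in Ioc 0 x, (ProbabilityTheory.exponentialPDF (1 / m) s).toReal • V (x - s) :=
    setIntegral_withDensity_eq_setIntegral_toReal_smul hmeas
      (ae_of_all _ fun s => ENNReal.ofReal_lt_top) _ measurableSet_Ioc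
  have h₂ : ∫ s in Ioc 0 x, (ProbabilityTheory.exponentialPDF (1 / m) s).toReal • V (x - s) =
      ∫ s in Ioc 0 x, 1 / m * Real.exp (-x / m) * (V (x - s) * Real.exp ((x - s) / m)) := by
    refine setIntegral_congr_fun measurableSet_Ioc fun s hs => ?_
    simp only [smul_eq_mul]
    rw [ProbabilityTheory.exponentialPDF_of_nonneg hs.1.le,
      ENNReal.toReal_ofReal (by positivity)]
    have : Real.exp (-(1 / m * s)) = Real.exp (-x / m) * Real.exp ((x - s) / m) := by
      rw [← Real.exp_add]; congr 1; ring
    rw [this]; ring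
  rw [h₁, h₂, ← intervalIntegral.integral_of_le hx, intervalIntegral.integral_const_mul,
    intervalIntegral.integral_comp_sub_left (fun y => V y * Real.exp (y / m)) x]
  simp

/-! ### The maximized HJB equation. -/

namespace SurplusModel

variable (P : SurplusModel)

/-- The coefficient of `V''` in the maximized HJB equation. -/
noncomputable def residualVariance : ℝ := (1 - P.ρ ^ 2) * P.σ₁ ^ 2 / 2

/-- The premium rate corrected by the hedge `-ρσ₁/σ`. -/
noncomputable def hedgedPremium : ℝ := P.c - (P.μ - P.r) * P.ρ * P.σ₁ / P.σ

/-- Half of the squared Sharpe ratio `(μ - r)/σ`. -/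
noncomputable def halfSqSharpe : ℝ := (P.μ - P.r) ^ 2 / (2 * P.σ ^ 2)

theorem residualVariance_pos (hσ₁ : 0 < P.σ₁) (hρ : |P.ρ| < 1) : 0 < P.residualVariance := by
  have : P.ρ ^ 2 < 1 := (sq_lt_one_iff_abs_lt_one P.ρ).2 hρ
  unfold residualVariance
  have : 0 < 1 - P.ρ ^ 2 := by linarith
  positivity

theorem halfSqSharpe_pos (hσ : 0 < P.σ) (hμr : P.μ ≠ P.r) : 0 < P.halfSqSharpe := by
  have := sub_ne_zero.2 hμr
  unfold halfSqSharpe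
  positivity

/-- Completion of the square in the investment `a`. -/
theorem generator_eq_sub_sq (hσ : 0 < P.σ) (F : Measure ℝ) {W : ℝ → ℝ} {x : ℝ}
    (hW : deriv (deriv W) x ≠ 0) (a : ℝ) :
    P.generator F a W x =
      P.residualVariance * deriv (deriv W) x + (P.hedgedPremium + P.r * x) * deriv W x
        - P.halfSqSharpe * deriv W x ^ 2 / deriv (deriv W) x - P.jumpTerm F W x
        + P.σ ^ 2 / 2 * deriv (deriv W) x * (a - P.optimalInvestment W x) ^ 2 := by
  unfold generator residualVariance hedgedPremium halfSqSharpe optimalInvestment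
  field_simp
  ring

theorem generator_lt_generator_optimalInvestment (hσ : 0 < P.σ) (F : Measure ℝ) {W : ℝ → ℝ}
    {x : ℝ} (hW : deriv (deriv W) x < 0) {a : ℝ} (ha : a ≠ P.optimalInvestment W x) :
    P.generator F a W x < P.generator F (P.optimalInvestment W x) W x := by
  rw [P.generator_eq_sub_sq hσ F hW.ne, P.generator_eq_sub_sq hσ F hW.ne (P.optimalInvestment W x)]
  have h₁ : 0 < (a - P.optimalInvestment W x) ^ 2 := by
    have := sub_ne_zero.2 ha
    positivity
  have h₂ : P.σ ^ 2 / 2 * deriv (deriv W) x * (a - P.optimalInvestment W x) ^ 2 < 0 :=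
    mul_neg_of_neg_of_pos (mul_neg_of_pos_of_neg (by positivity) hW) h₁
  simp only [sub_self]
  linarith

/-- The HJB equation is the vanishing of the generator at the optimal investment. -/
theorem isLUB_generator_iff (hσ : 0 < P.σ) (F : Measure ℝ) {W : ℝ → ℝ} {x : ℝ}
    (hW : deriv (deriv W) x < 0) :
    IsLUB (range fun a : ℝ => P.generator F a W x) 0 ↔
      P.residualVariance * deriv (deriv W) x + (P.hedgedPremium + P.r * x) * deriv W x
        - P.halfSqSharpe * deriv W x ^ 2 / deriv (deriv W) x - P.jumpTerm F W x = 0 := by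
  have hval := P.generator_eq_sub_sq hσ F hW.ne (P.optimalInvestment W x)
  simp only [sub_self, ne_eq, OfNat.ofNat_ne_zero, not_false_eq_true, zero_pow, mul_zero,
    add_zero] at hval
  rw [← hval]
  have hmax : IsGreatest (range fun a : ℝ => P.generator F a W x)
      (P.generator F (P.optimalInvestment W x) W x) := by
    refine ⟨⟨_, rfl⟩, ?_⟩
    rintro _ ⟨a, rfl⟩
    rcases eq_or_ne a (P.optimalInvestment W x) with rfl | ha
    · exact le_rfl
    · exact (P.generator_lt_generator_optimalInvestment hσ F hW ha).le
  exact ⟨fun h => hmax.isLUB.unique h, fun h => h ▸ hmax.isLUB⟩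

end SurplusModel

/-! ### Long-time behaviour of the scalar equation. -/

section Asymptotics

variable {A R k r lam m : ℝ} {h : ℝ → ℝ}

theorem hasDerivAt_affine_sub {h' x : ℝ} (hh : HasDerivAt h h' x) :
    HasDerivAt (fun y => k + r * y - lam * h y) (r - lam * h') x := by
  have h₁ := (((hasDerivAt_id x).const_mul r).const_add k).sub (hh.const_mul lam)
  exact HasDerivAt.congr_deriv (f := fun y => k + r * y - lam * h y) h₁ (by ring)

/-- Along a solution of the equation for `h`, the Riccati root is eventually at most `2/m`. -/
theorem eventually_riccatiRoot_le (hA : 0 < A) (hR : 0 < R) (hr : 0 < r) (hlam : 0 < lam)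
    (hm : 0 < m) (hpos : ∀ x, 0 < x → 0 < h x)
    (hder : ∀ x, 0 < x →
      HasDerivAt h (1 + h x * (riccatiRoot A R (k + r * x - lam * h x) - 1 / m)) x) :
    ∀ᶠ x in atTop, riccatiRoot A R (k + r * x - lam * h x) ≤ 2 / m := by
  set w : ℝ → ℝ := fun x => riccatiRoot A R (k + r * x - lam * h x) with hw
  have hm2 : 0 < 2 / m := by positivity
  set θ := A * (2 / m) - R / (2 / m) with hθ
  have hwθ : ∀ x, w x ≤ 2 / m ↔ k + r * x - lam * h x ≤ θ := fun x =>
    riccatiRoot_le_iff hA hR hm2 _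
  -- While `w > 2/m`, `h' ≥ 1 + h/m`, so `h` grows at least linearly and then at least
  -- quadratically. This beats `r x` and drives `k + r x - λ h` below `θ`, a contradiction.
  have hexit : ∀ X, 0 < X → ∃ x₁, X ≤ x₁ ∧ w x₁ ≤ 2 / m := by
    intro X hX
    by_contra! hcon
    have hgrow : ∀ x, X ≤ x → 1 + h x / m ≤ 1 + h x * (w x - 1 / m) := by
      intro x hx
      have h₁ : 1 / m ≤ w x - 1 / m := by
        have := hcon x hx
        have h2 : 2 / m = 1 / m + 1 / m := by ring
        linarith
      have := mul_le_mul_of_nonneg_left h₁ (hpos x (hX.trans_le hx)).le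
      rw [mul_one_div] at this
      linarith
    have hlin : ∀ y, X ≤ y → y - X ≤ h y := by
      intro y hy
      exact image_le_of_deriv_right_le_deriv_boundary (a := X) (b := y) (f := fun x => x - X)
        (f' := fun _ => 1) (B := h) (B' := fun x => 1 + h x * (w x - 1 / m))
        (by fun_prop) (fun x _ => ((hasDerivAt_id x).sub_const X).hasDerivWithinAt)
        (by simpa using (hpos X hX).le)
        (fun x hx => (hder x (hX.trans_le hx.1)).continuousAt.continuousWithinAt)
        (fun x hx => (hder x (hX.trans_le hx.1)).hasDerivWithinAt)
        (fun x hx => by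
          have := div_pos (hpos x (hX.trans_le hx.1)) hm
          linarith [hgrow x hx.1]) ⟨hy, le_rfl⟩
    have hquad : ∀ y, X ≤ y → (y - X) ^ 2 / (2 * m) ≤ h y := by
      intro y hy
      exact image_le_of_deriv_right_le_deriv_boundary (a := X) (b := y)
        (f := fun x => (x - X) ^ 2 / (2 * m))
        (f' := fun x => (x - X) / m) (B := h) (B' := fun x => 1 + h x * (w x - 1 / m))
        (by fun_prop)
        (fun x _ => by
          have := (((hasDerivAt_id x).sub_const X).pow 2).div_const (2 * m)
          refine (this.congr_deriv ?_).hasDerivWithinAt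
          simp only [id_eq]
          field_simp
          ring)
        (by simpa using (hpos X hX).le)
        (fun x hx => (hder x (hX.trans_le hx.1)).continuousAt.continuousWithinAt)
        (fun x hx => (hder x (hX.trans_le hx.1)).hasDerivWithinAt)
        (fun x hx => by
          have := div_le_div_of_nonneg_right (hlin x hx.1) hm.le
          linarith [hgrow x hx.1]) ⟨hy, le_rfl⟩
    set C := |k + r * X - θ| with hC
    have hCn : 0 ≤ C := abs_nonneg _
    -- Chosen so that `λ t^2 / (2m) > (r + C) t ≥ r t + C`.
    set t := 2 * m / lam * (r + C) + 1 with ht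
    have ht1 : 1 ≤ t := by
      have : 0 ≤ 2 * m / lam * (r + C) := by positivity
      linarith
    have h₁ := hquad (X + t) (by linarith)
    have h₂ : ¬ (k + r * (X + t) - lam * h (X + t) ≤ θ) := by
      rw [← hwθ]; exact not_le.2 (hcon (X + t) (by linarith))
    rw [add_sub_cancel_left] at h₁
    have h₃ : r + C < lam * t / (2 * m) := by
      rw [ht, lt_div_iff₀ (by positivity)]
      have : lam * (2 * m / lam * (r + C) + 1) = (r + C) * (2 * m) + lam := by field_simp
      linarith
    have h₄ : lam * (t ^ 2 / (2 * m)) ≤ lam * h (X + t) := mul_le_mul_of_nonneg_left h₁ hlam.le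
    have h₅ : lam * (t ^ 2 / (2 * m)) = lam * t / (2 * m) * t := by ring
    have h₆ : (r + C) * t ≤ lam * t / (2 * m) * t :=
      mul_le_mul_of_nonneg_right h₃.le (by linarith)
    have h₇ : C ≤ C * t := le_mul_of_one_le_right hCn ht1
    have h₈ : k + r * X - θ ≤ C := le_abs_self _
    exact h₂ (by nlinarith)
  -- Beyond this threshold, `k + r x - λ h = θ` implies `λ h > m r`, so the derivative `r - λ - λ h
  -- / m` is negative there and `θ` is a barrier.
  obtain ⟨x₁, hx₁, hwx₁⟩ := hexit (max 1 ((m * r - k + θ) / r + 1)) (by positivity)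
  have hx₁pos : 0 < x₁ := lt_of_lt_of_le one_pos ((le_max_left _ _).trans hx₁)
  have hx₁r : m * r - k + θ < r * x₁ := by
    have : (m * r - k + θ) / r < x₁ := by linarith [(le_max_right _ _).trans hx₁]
    rw [div_lt_iff₀ hr] at this
    linarith
  filter_upwards [eventually_ge_atTop x₁] with y hy
  rw [hwθ]
  refine image_le_of_deriv_right_lt_deriv_boundary (a := x₁) (b := y)
    (f := fun x => k + r * x - lam * h x)
    (f' := fun x => r - lam * (1 + h x * (w x - 1 / m))) (B := fun _ => θ) (B' := fun _ => 0)
    (fun x hx => ?_) (fun x hx => ?_) ((hwθ x₁).1 hwx₁) (fun x => hasDerivAt_const x _)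
    (fun x hx hEq => ?_) ⟨hy, le_rfl⟩
  · have := (hder x (hx₁pos.trans_le hx.1)).continuousAt.continuousWithinAt (s := Icc x₁ y)
    fun_prop
  · exact (hasDerivAt_affine_sub (hder x (hx₁pos.trans_le hx.1))).hasDerivWithinAt
  · have hwx : w x = 2 / m :=
      le_antisymm ((hwθ x).2 hEq.le) ((le_riccatiRoot_iff hA hR hm2 _).2 hEq.ge)
    have h₁ : m * r < lam * h x := by
      have : r * x₁ ≤ r * x := mul_le_mul_of_nonneg_left hx.1 hr.le
      linarith
    have h₂ : lam * (1 + h x * (w x - 1 / m)) = lam + lam * h x / m := by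
      rw [hwx]; field_simp; ring
    have h₃ : r < lam * h x / m := by rw [lt_div_iff₀ hm]; linarith
    rw [h₂]; linarith

/-- Along a solution of the equation for `h`, the Riccati root is eventually at least `1/(2m)`. -/
theorem eventually_le_riccatiRoot (hA : 0 < A) (hR : 0 < R) (hr : 0 < r) (hlam : 0 < lam)
    (hm : 0 < m)
    (hder : ∀ x, 0 < x →
      HasDerivAt h (1 + h x * (riccatiRoot A R (k + r * x - lam * h x) - 1 / m)) x) :
    ∀ᶠ x in atTop, 1 / (2 * m) ≤ riccatiRoot A R (k + r * x - lam * h x) := by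
  have hm2 : 0 < 1 / (2 * m) := by positivity
  set θ := A * (1 / (2 * m)) - R / (1 / (2 * m)) with hθ
  -- Past the threshold, `k + r x - λ h ≤ θ` forces `λ h ≥ 2 m λ` and `w - 1/m ≤ -1/(2m)`. Hence `k
  -- + r x - λ h` increases at rate at least `r`.
  have hev : ∀ᶠ x in atTop, -(k + r * x - lam * h x) ≤ -θ := by
    refine eventually_le_of_deriv_le_neg (δ := r) hr (X := max 1 ((2 * m * lam - k + θ) / r))
      (f' := fun x => -(r -
        lam * (1 + h x * (riccatiRoot A R (k + r * x - lam * h x) - 1 / m))))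
      (fun x hx => ?_) (fun x hx hθx => ?_)
    · have hx0 : 0 < x := lt_of_lt_of_le one_pos ((le_max_left _ _).trans hx)
      exact (hasDerivAt_affine_sub (hder x hx0)).neg
    · have hθx' : k + r * x - lam * h x ≤ θ := by linarith
      have hwx := (riccatiRoot_le_iff hA hR hm2 _).2 hθx'
      set w := riccatiRoot A R (k + r * x - lam * h x)
      have hxr : 2 * m * lam - k + θ ≤ x * r :=
        (div_le_iff₀ hr).1 ((le_max_right _ _).trans hx)
      have hQ : 2 * m * lam ≤ lam * h x := by linarith
      have hw' : w - 1 / m ≤ -(1 / (2 * m)) := by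
        have : 1 / m = 1 / (2 * m) + 1 / (2 * m) := by field_simp; ring
        linarith
      have h₁ := mul_le_mul_of_nonneg_left hw' ((by positivity : 0 ≤ 2 * m * lam).trans hQ)
      have h₂ := mul_le_mul_of_nonneg_right hQ hm2.le
      have h₃ : 2 * m * lam * (1 / (2 * m)) = lam := by field_simp
      nlinarith
  filter_upwards [hev] with x hx
  exact (le_riccatiRoot_iff hA hR hm2 _).2 (by linarith)

/-- The deviation of the Riccati root from `1/m` is `(1 - λ/r)/x` to leading order. -/
theorem tendsto_mul_riccatiRoot_sub (hA : 0 < A) (hR : 0 < R) (hr : 0 < r) (hlam : 0 < lam)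
    (hm : 0 < m) (hpos : ∀ x, 0 < x → 0 < h x)
    (hder : ∀ x, 0 < x →
      HasDerivAt h (1 + h x * (riccatiRoot A R (k + r * x - lam * h x) - 1 / m)) x) :
    Tendsto (fun x => x * (riccatiRoot A R (k + r * x - lam * h x) - 1 / m)) atTop
      (𝓝 (1 - lam / r)) := by
  have hup := eventually_riccatiRoot_le hA hR hr hlam hm hpos hder
  have hlow := eventually_le_riccatiRoot hA hR hr hlam hm hder
  set β : ℝ → ℝ := fun x => k + r * x - lam * h x with hβ
  set w : ℝ → ℝ := fun x => riccatiRoot A R (β x) with hw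
  have hm2 : 0 < 1 / (2 * m) := by positivity
  have hm2' : 0 < 2 / m := by positivity
  set θ₁ := A * (1 / (2 * m)) - R / (1 / (2 * m))
  set θ₂ := A * (2 / m) - R / (2 / m)
  set D : ℝ → ℝ := fun x => A + R / w x ^ 2 with hD
  have hβup : ∀ᶠ x in atTop, β x ≤ θ₂ := hup.mono fun x hx => (riccatiRoot_le_iff hA hR hm2' _).1 hx
  have hβlow : ∀ᶠ x in atTop, θ₁ ≤ β x :=
    hlow.mono fun x hx => (le_riccatiRoot_iff hA hR hm2 _).1 hx
  have hDpos : ∀ x, 0 < D x := fun x => by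
    have := riccatiRoot_pos hA hR (β x)
    positivity
  set M := A + R / (1 / (2 * m)) ^ 2 with hM
  have hDM : ∀ᶠ x in atTop, D x ≤ M := hlow.mono fun x hx => by
    simp only [hD, hM]
    gcongr
  have hβx : Tendsto (fun x => β x / x) atTop (𝓝 0) := by
    have hbdd : ∀ᶠ x in atTop, ‖β x‖ ≤ |θ₁| + |θ₂| := by
      filter_upwards [hβup, hβlow] with x h₁ h₂
      rw [Real.norm_eq_abs, abs_le]
      constructor
      · linarith [neg_abs_le θ₁, abs_nonneg θ₂]
      · linarith [le_abs_self θ₂, abs_nonneg θ₁]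
    have := tendsto_inv_atTop_zero (𝕜 := ℝ)
    exact (this.zero_mul_isBoundedUnder_le ⟨_, eventually_map.2 hbdd⟩).congr fun x => by
      simp [div_eq_mul_inv, mul_comm]
  have hDx : Tendsto (fun x => D x / x ^ 2) atTop (𝓝 0) := by
    have hbdd : ∀ᶠ x in atTop, ‖D x‖ ≤ M := by
      filter_upwards [hDM] with x h₁
      rwa [Real.norm_of_nonneg (hDpos x).le]
    have := tendsto_inv_atTop_zero.comp (tendsto_pow_atTop (α := ℝ) two_ne_zero)
    exact (this.zero_mul_isBoundedUnder_le ⟨_, eventually_map.2 hbdd⟩).congr fun x => by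
      simp [div_eq_mul_inv, mul_comm]
  have hQx : Tendsto (fun x => lam * h x / x) atTop (𝓝 r) := by
    have h₁ : Tendsto (fun x : ℝ => k / x) atTop (𝓝 0) := tendsto_const_nhds.div_atTop tendsto_id
    have h₂ := (h₁.add_const r).sub hβx
    simp only [zero_add, sub_zero] at h₂
    refine h₂.congr' ?_
    filter_upwards [eventually_gt_atTop 0] with x hx
    simp only [hβ]
    field_simp
    ring
  -- The moving equilibrium: with `z = x (w - 1/m)` and `w' = B' / D`, one finds `z' = (λ h / D -
  -- 1/x) (b - z)` for this `b`.
  have hb : Tendsto (fun x => (r - lam) / (lam * h x / x - D x / x ^ 2)) atTop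
      (𝓝 (1 - lam / r)) := by
    have h₁ := (tendsto_const_nhds (x := r - lam)).div (hQx.sub hDx) (by simpa using hr.ne')
    have h₂ : (r - lam) / (r - 0) = 1 - lam / r := by rw [sub_zero]; field_simp
    rw [← h₂]
    exact h₁
  -- `B` is bounded above, so `λ h → ∞`, while `D ≤ M`; this keeps the relaxation rate at least `2 -
  -- 1`.
  have hQ2 : ∀ᶠ x in atTop, 2 * M ≤ lam * h x := by
    have h₁ : Tendsto (fun x : ℝ => k - θ₂ + r * x) atTop atTop :=
      tendsto_atTop_add_const_left _ _ (tendsto_id.const_mul_atTop hr)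
    filter_upwards [h₁.eventually_ge_atTop (2 * M), hβup] with x hx₁ hx₂
    simp only [hβ] at hx₂
    linarith
  have hrate : ∀ᶠ x in atTop, 1 ≤ lam * h x / D x - 1 / x := by
    filter_upwards [hQ2, hDM, eventually_ge_atTop 1] with x h₁ h₂ h₃
    have h₄ : 2 ≤ lam * h x / D x := by rw [le_div_iff₀ (hDpos x)]; linarith
    have h₅ : 1 / x ≤ 1 := by rw [div_le_one (by linarith)]; exact h₃
    linarith
  refine tendsto_of_hasDerivAt_relaxation one_pos hrate hb ?_
  filter_upwards [eventually_gt_atTop 0, hrate] with x hx hax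
  have hβ' : HasDerivAt β (r - lam * (1 + h x * (w x - 1 / m))) x :=
    hasDerivAt_affine_sub (hder x hx)
  have hw' : HasDerivAt w ((D x)⁻¹ * (r - lam * (1 + h x * (w x - 1 / m)))) x :=
    (hasDerivAt_riccatiRoot hA hR (β x)).comp x hβ'
  have hz := (hasDerivAt_id x).mul (hw'.sub_const (1 / m))
  refine hz.congr_deriv ?_
  have hDx0 := (hDpos x).ne'
  have hden : lam * h x / x - D x / x ^ 2 = (lam * h x / D x - 1 / x) * (D x / x) := by
    field_simp
  have hcancel : (lam * h x / D x - 1 / x) * ((r - lam) / (lam * h x / x - D x / x ^ 2)) =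
      (r - lam) / (D x / x) := by
    rw [hden, ← div_div, mul_div_assoc', mul_div_cancel₀ _ (by linarith)]
  rw [mul_sub (lam * h x / D x - 1 / x), hcancel]
  change 1 * (w x - 1 / m) + x * ((D x)⁻¹ * (r - lam * (1 + h x * (w x - 1 / m)))) =
    (r - lam) / (D x / x) - (lam * h x / D x - 1 / x) * (x * (w x - 1 / m))
  field_simp
  ring

end Asymptotics

/-! ### Reduction of the HJB equation and the investment asymptotics. -/

/-- For exponential claims the jump part of the generator, multiplied by `exp (x / m)`, is the
primitive of `V'(x) exp (x / m)` that vanishes at `0`. -/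
theorem exists_primitive_jump {m : ℝ} (hm : 0 < m) {V u : ℝ → ℝ} (hV : ContinuousOn V (Ici 0))
    (hV0 : V 0 = 0) (hu : ∀ x, 0 < x → HasDerivAt V (u x) x) :
    ∃ E : ℝ → ℝ, ContinuousOn E (Ici 0) ∧ E 0 = 0 ∧
      (∀ x, 0 < x → HasDerivAt E (u x * Real.exp (x / m)) x) ∧
      ∀ x, 0 < x → V x - ∫ s in Ioc 0 x, V (x - s) ∂(ProbabilityTheory.expMeasure (1 / m)) =
        Real.exp (-x / m) * E x := by
  -- Freezing `V` at `V 0` on the negative axis gives a continuous integrand on `ℝ`, as `V` is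
  -- uncontrolled there.
  have hVc : Continuous fun x : ℝ => V (max x 0) :=
    hV.comp_continuous (by fun_prop) fun x => le_max_right x 0
  have hint : Continuous fun x : ℝ => V (max x 0) * Real.exp (x / m) :=
    hVc.mul (by fun_prop)
  have hΦ : ∀ x, HasDerivAt (fun x : ℝ => ∫ y in (0 : ℝ)..x, V (max y 0) * Real.exp (y / m))
      (V (max x 0) * Real.exp (x / m)) x := fun x =>
    (hint.integral_hasStrictDerivAt 0 x).hasDerivAt
  have hexp : ∀ x, HasDerivAt (fun x : ℝ => Real.exp (x / m)) (Real.exp (x / m) * (1 / m)) x :=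
    fun x => ((hasDerivAt_id x).div_const m).exp
  refine ⟨fun x => V x * Real.exp (x / m) -
    1 / m * ∫ y in (0 : ℝ)..x, V (max y 0) * Real.exp (y / m), ?_, ?_, ?_, ?_⟩
  · have h₁ : Continuous fun x : ℝ => ∫ y in (0 : ℝ)..x, V (max y 0) * Real.exp (y / m) :=
      continuous_iff_continuousAt.2 fun x => (hΦ x).continuousAt
    fun_prop
  · simp [hV0]
  · intro x hx
    have h₁ := ((hu x hx).mul (hexp x)).sub ((hΦ x).const_mul (1 / m))
    refine HasDerivAt.congr_deriv (f := fun x => V x * Real.exp (x / m) -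
      1 / m * ∫ y in (0 : ℝ)..x, V (max y 0) * Real.exp (y / m)) h₁ ?_
    rw [max_eq_left hx.le]
    ring
  · intro x hx
    have h₁ : ∫ y in (0 : ℝ)..x, V (max y 0) * Real.exp (y / m) =
        ∫ y in (0 : ℝ)..x, V y * Real.exp (y / m) := by
      refine intervalIntegral.integral_congr fun y hy => ?_
      rw [uIcc_of_le hx.le] at hy
      simp only [max_eq_left hy.1]
    have h₂ : Real.exp (-x / m) * Real.exp (x / m) = 1 := by
      rw [← Real.exp_add, neg_div, neg_add_cancel, Real.exp_zero]
    rw [setIntegral_expMeasure_comp_sub hm V hx.le, ← h₁]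
    linear_combination -(V x) * h₂

namespace SurplusModel

variable {P : SurplusModel} {m : ℝ} {V : ℝ → ℝ}

/-- Every solution of the HJB equation with exponential claims satisfies `-V''/V' = w`, where `w`
is the Riccati root attached to `h = M(V)/(λ V')`, and `h' = 1 + h (w - 1/m)`. -/
theorem IsHJBSolution.exists_reduced
    (hV : P.IsHJBSolution (ProbabilityTheory.expMeasure (1 / m)) V)
    (hσ : 0 < P.σ) (hσ₁ : 0 < P.σ₁) (hρ : |P.ρ| < 1) (hμr : P.μ ≠ P.r) (hm : 0 < m) :
    ∃ h : ℝ → ℝ, (∀ x, 0 < x → 0 < h x) ∧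
      (∀ x, 0 < x → HasDerivAt h (1 + h x * (riccatiRoot P.residualVariance P.halfSqSharpe
        (P.hedgedPremium + P.r * x - P.lam * h x) - 1 / m)) x) ∧
      ∀ x, 0 < x → -deriv (deriv V) x / deriv V x = riccatiRoot P.residualVariance P.halfSqSharpe
        (P.hedgedPremium + P.r * x - P.lam * h x) := by
  have hA := P.residualVariance_pos hσ₁ hρ
  have hR := P.halfSqSharpe_pos hσ hμr
  have hu : ∀ x, 0 < x → HasDerivAt V (deriv V x) x := fun x hx =>
    ((hV.contDiffOn.contDiffAt (Ioi_mem_nhds hx)).differentiableAt (by norm_num)).hasDerivAt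
  have hu' : ∀ x, 0 < x → HasDerivAt (deriv V) (deriv (deriv V) x) x := fun x hx =>
    ((((contDiffOn_succ_iff_deriv_of_isOpen (n := 1) isOpen_Ioi).1
      (by simpa [one_add_one_eq_two] using hV.contDiffOn)).2.2.contDiffAt
        (Ioi_mem_nhds hx)).differentiableAt (by norm_num)).hasDerivAt
  obtain ⟨E, hEc, hE0, hE', hEj⟩ := exists_primitive_jump hm hV.continuousOn hV.zero hu
  have hEpos : ∀ x, 0 < x → 0 < E x := by
    have hmono : StrictMonoOn E (Ici 0) := by
      refine strictMonoOn_of_deriv_pos (convex_Ici 0) hEc fun x hx => ?_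
      rw [interior_Ici] at hx
      rw [(hE' x hx).deriv]
      exact mul_pos (hV.deriv_pos x hx) (Real.exp_pos _)
    intro x hx
    have := hmono self_mem_Ici hx.le hx
    rwa [hE0] at this
  have hroot : ∀ x, 0 < x → -deriv (deriv V) x / deriv V x =
      riccatiRoot P.residualVariance P.halfSqSharpe (P.hedgedPremium + P.r * x -
        P.lam * (Real.exp (-x / m) * E x / deriv V x)) := by
    intro x hx
    have hp := hV.deriv_pos x hx
    have hn := hV.deriv_deriv_neg x hx
    refine eq_riccatiRoot_of_root hA hR (div_pos (neg_pos.2 hn) hp) ?_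
    have hjb := (P.isLUB_generator_iff hσ _ hn).1 (hV.hjb x hx)
    rw [jumpTerm, hEj x hx] at hjb
    have hn' := hn.ne
    field_simp at hjb ⊢
    linear_combination hjb
  refine ⟨fun x => Real.exp (-x / m) * E x / deriv V x, fun x hx => ?_, fun x hx => ?_, hroot⟩
  · exact div_pos (mul_pos (Real.exp_pos _) (hEpos x hx)) (hV.deriv_pos x hx)
  · have hp := hV.deriv_pos x hx
    rw [← hroot x hx]
    have hexp : HasDerivAt (fun x : ℝ => Real.exp (-x / m)) (Real.exp (-x / m) * (-1 / m)) x :=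
      ((hasDerivAt_neg x).div_const m).exp
    refine HasDerivAt.congr_deriv (f := fun x => Real.exp (-x / m) * E x / deriv V x)
      ((hexp.mul (hE' x hx)).div (hu' x hx) hp.ne') ?_
    have h₂ : Real.exp (-x / m) * Real.exp (x / m) = 1 := by
      rw [← Real.exp_add, neg_div, neg_add_cancel, Real.exp_zero]
    simp only [Pi.mul_apply]
    generalize Real.exp (-x / m) = e₁ at h₂ ⊢
    field_simp
    linear_combination (m * deriv V x ^ 2) * h₂

/-- With `w = -V''/V'`, the deviation from the limit is `-((μ - r) m / σ²) (w - 1/m) / w`, and `x (w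
- 1/m) → 1 - λ/r`, `w → 1/m`. The other asymptotic statements follow by algebra. -/
theorem IsHJBSolution.tendsto_mul_sub_limitInvestment
    (hV : P.IsHJBSolution (ProbabilityTheory.expMeasure (1 / m)) V)
    (hr : 0 < P.r) (hσ : 0 < P.σ) (hσ₁ : 0 < P.σ₁) (hlam : 0 < P.lam) (hρ : |P.ρ| < 1)
    (hμr : P.μ ≠ P.r) (hm : 0 < m) :
    Tendsto (fun x => x * (P.optimalInvestment V x - P.limitInvestment m)) atTop
      (𝓝 (-P.rateCoeff m)) := by
  obtain ⟨h, hpos, hder, hroot⟩ := hV.exists_reduced hσ hσ₁ hρ hμr hm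
  have hz := tendsto_mul_riccatiRoot_sub (P.residualVariance_pos hσ₁ hρ)
    (P.halfSqSharpe_pos hσ hμr) hr hlam hm hpos hder
  have hz' : Tendsto (fun x => x * (-deriv (deriv V) x / deriv V x - 1 / m)) atTop
      (𝓝 (1 - P.lam / P.r)) := by
    refine hz.congr' ?_
    filter_upwards [eventually_gt_atTop 0] with x hx
    rw [hroot x hx]
  have hw : Tendsto (fun x => -deriv (deriv V) x / deriv V x) atTop (𝓝 (1 / m)) := by
    have h₁ := (hz'.mul tendsto_inv_atTop_zero).const_add (1 / m)
    rw [mul_zero, add_zero] at h₁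
    refine h₁.congr' ?_
    filter_upwards [eventually_gt_atTop 0] with x hx
    field_simp
    ring
  have hlim := (hz'.const_mul (-((P.μ - P.r) * m / P.σ ^ 2))).div hw (by positivity)
  have hval : -((P.μ - P.r) * m / P.σ ^ 2) * (1 - P.lam / P.r) / (1 / m) = -P.rateCoeff m := by
    unfold rateCoeff
    field_simp
  rw [hval] at hlim
  refine hlim.congr' ?_
  filter_upwards [eventually_gt_atTop 0] with x hx
  have hp := (hV.deriv_pos x hx).ne'
  have hn := (hV.deriv_deriv_neg x hx).ne
  simp only [Pi.div_apply, optimalInvestment, limitInvestment]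
  field_simp
  ring

theorem IsHJBSolution.isLittleO_optimalInvestment
    (hV : P.IsHJBSolution (ProbabilityTheory.expMeasure (1 / m)) V)
    (hr : 0 < P.r) (hσ : 0 < P.σ) (hσ₁ : 0 < P.σ₁) (hlam : 0 < P.lam) (hρ : |P.ρ| < 1)
    (hμr : P.μ ≠ P.r) (hm : 0 < m) :
    (fun x => P.optimalInvestment V x - (P.limitInvestment m - P.rateCoeff m * (1 / x)))
      =o[atTop] (fun x : ℝ => 1 / x) := by
  have h₁ := (hV.tendsto_mul_sub_limitInvestment hr hσ hσ₁ hlam hρ hμr hm).add_const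
    (P.rateCoeff m)
  rw [neg_add_cancel] at h₁
  refine (isLittleO_iff_tendsto' ?_).2 (h₁.congr' ?_)
  · filter_upwards [eventually_gt_atTop 0] with x hx hx0
    exact absurd hx0 (by positivity)
  · filter_upwards [eventually_gt_atTop 0] with x hx
    field_simp
    ring

theorem IsHJBSolution.tendsto_optimalInvestment
    (hV : P.IsHJBSolution (ProbabilityTheory.expMeasure (1 / m)) V)
    (hr : 0 < P.r) (hσ : 0 < P.σ) (hσ₁ : 0 < P.σ₁) (hlam : 0 < P.lam) (hρ : |P.ρ| < 1)
    (hμr : P.μ ≠ P.r) (hm : 0 < m) :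
    Tendsto (P.optimalInvestment V) atTop (𝓝 (P.limitInvestment m)) := by
  have h₁ := ((hV.tendsto_mul_sub_limitInvestment hr hσ hσ₁ hlam hρ hμr hm).mul
    tendsto_inv_atTop_zero).add_const (P.limitInvestment m)
  rw [mul_zero, zero_add] at h₁
  refine h₁.congr' ?_
  filter_upwards [eventually_gt_atTop 0] with x hx
  field_simp
  ring

theorem IsHJBSolution.exists_optimalInvestment_eq_mul
    (hV : P.IsHJBSolution (ProbabilityTheory.expMeasure (1 / m)) V)
    (hr : 0 < P.r) (hσ : 0 < P.σ) (hσ₁ : 0 < P.σ₁) (hlam : 0 < P.lam) (hρ : |P.ρ| < 1)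
    (hμr : P.μ ≠ P.r) (hm : 0 < m) (hlr : P.lam ≠ P.r) :
    ∃ ε : ℝ → ℝ, Tendsto ε atTop (𝓝 0) ∧ ∀ x, 0 < x → P.optimalInvestment V x =
      P.limitInvestment m - P.rateCoeff m * (1 / x) * (1 + ε x) := by
  have hrate : P.rateCoeff m ≠ 0 := by
    have h₁ : 1 - P.lam / P.r ≠ 0 := by
      rw [sub_ne_zero, ne_comm, Ne, div_eq_one_iff_eq hr.ne']
      exact hlr
    have h₂ := sub_ne_zero.2 hμr
    unfold rateCoeff
    positivity
  -- The required identity solved for `ε x`, which needs a nonzero `rateCoeff`.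
  refine ⟨fun x => x * (P.optimalInvestment V x - P.limitInvestment m) / (-P.rateCoeff m) - 1,
    ?_, fun x hx => ?_⟩
  · have h₁ := ((hV.tendsto_mul_sub_limitInvestment hr hσ hσ₁ hlam hρ hμr hm).div_const
      (-P.rateCoeff m)).sub_const 1
    rwa [div_self (neg_ne_zero.2 hrate), sub_self] at h₁
  · field_simp
    ring

end SurplusModel

/-! ### Existence of a solution. -/

/-- The equation `h' = 1 + h (w - 1/m)`, with `w` the Riccati root at `k + r x - λ h`, has a
nonnegative solution on `[0, ∞)` starting from `0`. -/
theorem exists_reduced_solution {A R k r lam m : ℝ} (hA : 0 < A) (hR : 0 < R) (hr : 0 < r)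
    (hlam : 0 < lam) (hm : 0 < m) :
    ∃ h : ℝ → ℝ, h 0 = 0 ∧ ContinuousOn h (Ici 0) ∧
      ∀ x, 0 < x →
        HasDerivAt h (1 + h x * (riccatiRoot A R (k + r * x - lam * h x) - 1 / m)) x := by
  set W := riccatiRoot A R with hW
  have hWc : Continuous W := continuous_riccatiRoot
  -- The equation for `g = h exp (t/m)`, which removes the term `-h/m`. The truncation `max y 0`
  -- makes the field positive for all states; then `g` increases from `0` and the truncation is
  -- inactive.
  set v : ℝ → ℝ → ℝ := fun t y => Real.exp (t / m) +
    max y 0 * W (k + r * t - lam * (max y 0 * Real.exp (-t / m))) with hv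
  -- The quadratic trades the product of state and root for a polynomial in the root alone. As the
  -- root is bounded on bounded times, this makes `v` bounded and Lipschitz in `y`.
  have hkey : ∀ t y, lam * Real.exp (-t / m) *
      (max y 0 * W (k + r * t - lam * (max y 0 * Real.exp (-t / m)))) =
      (k + r * t) * W (k + r * t - lam * (max y 0 * Real.exp (-t / m))) + R
        - A * W (k + r * t - lam * (max y 0 * Real.exp (-t / m))) ^ 2 := fun t y => by
    linear_combination riccatiRoot_eq hA hR (k + r * t - lam * (max y 0 * Real.exp (-t / m)))
  have hWpos : ∀ B, 0 < W B := riccatiRoot_pos hA hR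
  have hkb : ∀ {T t : ℝ}, t ∈ Icc 0 T → |k + r * t| ≤ |k| + r * T := fun {T t} ht => by
    refine (abs_add_le _ _).trans ?_
    rw [abs_of_nonneg (mul_nonneg hr.le ht.1)]
    have := mul_le_mul_of_nonneg_left ht.2 hr.le
    linarith
  have hWM : ∀ {T t : ℝ}, t ∈ Icc 0 T → ∀ y,
      W (k + r * t - lam * (max y 0 * Real.exp (-t / m))) ≤ W (|k| + r * T) := by
    intro T t ht y
    refine riccatiRoot_mono hA hR ?_
    have h₁ : 0 ≤ lam * (max y 0 * Real.exp (-t / m)) := by positivity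
    linarith [le_abs_self (k + r * t), hkb ht]
  have hlip : ∀ T : ℝ, ∃ K : NNReal, ∀ t ∈ Icc 0 T, LipschitzWith K (v t) := by
    intro T
    set M := W (|k| + r * T)
    refine ⟨Real.toNNReal ((|k| + r * T + 2 * A * M) / A), fun t ht => ?_⟩
    refine LipschitzWith.of_dist_le_mul fun y₁ y₂ => ?_
    rw [Real.dist_eq, Real.dist_eq]
    refine le_trans ?_ (mul_le_mul_of_nonneg_right (Real.le_coe_toNNReal _) (abs_nonneg _))
    have hη : 0 < lam * Real.exp (-t / m) := by positivity
    refine le_of_mul_le_mul_left ?_ hη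
    have hk₁ := hkey t y₁
    have hk₂ := hkey t y₂
    have hM₁ := hWM ht y₁
    have hM₂ := hWM ht y₂
    have hL := abs_riccatiRoot_sub_le hA hR
      (k + r * t - lam * (max y₁ 0 * Real.exp (-t / m)))
      (k + r * t - lam * (max y₂ 0 * Real.exp (-t / m)))
    have hp₁ := hWpos (k + r * t - lam * (max y₁ 0 * Real.exp (-t / m)))
    have hp₂ := hWpos (k + r * t - lam * (max y₂ 0 * Real.exp (-t / m)))
    change |W _ - W _| ≤ _ at hL
    simp only [hv]
    set w₁ := W (k + r * t - lam * (max y₁ 0 * Real.exp (-t / m)))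
    set w₂ := W (k + r * t - lam * (max y₂ 0 * Real.exp (-t / m)))
    have hB := hkb ht
    have hfac : |k + r * t - A * (w₁ + w₂)| ≤ |k| + r * T + 2 * A * M := by
      rw [abs_le] at hB ⊢
      have h₁ := mul_le_mul_of_nonneg_left (add_le_add hM₁ hM₂) hA.le
      have h₂ : 0 ≤ A * (w₁ + w₂) := by positivity
      constructor <;> linarith
    have hdiff : |k + r * t - lam * (max y₁ 0 * Real.exp (-t / m)) -
        (k + r * t - lam * (max y₂ 0 * Real.exp (-t / m)))| ≤
        lam * Real.exp (-t / m) * |y₁ - y₂| := by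
      have : k + r * t - lam * (max y₁ 0 * Real.exp (-t / m)) -
        (k + r * t - lam * (max y₂ 0 * Real.exp (-t / m))) =
          -(lam * Real.exp (-t / m) * (max y₁ 0 - max y₂ 0)) := by ring
      rw [this, abs_neg, abs_mul, abs_of_pos hη]
      exact mul_le_mul_of_nonneg_left (abs_max_sub_max_le_abs _ _ _) hη.le
    calc lam * Real.exp (-t / m) *
          |Real.exp (t / m) + max y₁ 0 * w₁ - (Real.exp (t / m) + max y₂ 0 * w₂)|
        = |lam * Real.exp (-t / m) * (max y₁ 0 * w₁ - max y₂ 0 * w₂)| := by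
          rw [abs_mul, abs_of_pos hη]
          congr 2
          ring
      _ = |w₁ - w₂| * |k + r * t - A * (w₁ + w₂)| := by
          rw [← abs_mul]
          congr 1
          linear_combination hk₁ - hk₂
      _ ≤ (A⁻¹ * (lam * Real.exp (-t / m) * |y₁ - y₂|)) * (|k| + r * T + 2 * A * M) := by
          refine mul_le_mul (hL.trans ?_) hfac (abs_nonneg _) (by positivity)
          exact mul_le_mul_of_nonneg_left hdiff (by positivity)
      _ = lam * Real.exp (-t / m) * ((|k| + r * T + 2 * A * M) / A * |y₁ - y₂|) := by
          ring
  have hbdd : ∀ T : ℝ, ∃ L : NNReal, ∀ t ∈ Icc 0 T, ∀ y, |v t y| ≤ L := by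
    intro T
    set M := W (|k| + r * T)
    refine ⟨Real.toNNReal (Real.exp (T / m) +
      ((|k| + r * T) * M + R) / (lam * Real.exp (-T / m))), fun t ht y => ?_⟩
    refine le_trans ?_ (Real.le_coe_toNNReal _)
    have hk₁ := hkey t y
    have hM₁ := hWM ht y
    have hp₁ := hWpos (k + r * t - lam * (max y 0 * Real.exp (-t / m)))
    simp only [hv]
    set w₁ := W (k + r * t - lam * (max y 0 * Real.exp (-t / m)))
    have hX : 0 ≤ max y 0 * w₁ := mul_nonneg (le_max_right _ _) hp₁.le
    rw [abs_of_nonneg (add_nonneg (Real.exp_pos _).le hX)]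
    refine add_le_add (Real.exp_le_exp.2 (div_le_div_of_nonneg_right ht.2 hm.le)) ?_
    rw [le_div_iff₀ (by positivity)]
    have hB := (le_abs_self _).trans (hkb ht)
    have hBn := (abs_nonneg _).trans (hkb ht)
    have hexp : Real.exp (-T / m) ≤ Real.exp (-t / m) :=
      Real.exp_le_exp.2 (div_le_div_of_nonneg_right (neg_le_neg ht.2) hm.le)
    calc max y 0 * w₁ * (lam * Real.exp (-T / m))
        ≤ max y 0 * w₁ * (lam * Real.exp (-t / m)) := by gcongr
      _ = (k + r * t) * w₁ + R - A * w₁ ^ 2 := by linear_combination hk₁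
      _ ≤ (|k| + r * T) * M + R := by
          have h₁ : (k + r * t) * w₁ ≤ (|k| + r * T) * M :=
            mul_le_mul hB hM₁ hp₁.le hBn
          have h₂ : 0 ≤ A * w₁ ^ 2 := by positivity
          linarith
  obtain ⟨g, hg0, hgc, hg'⟩ := exists_global_solution_of_bounded_lipschitz (v := v)
    (fun y => by fun_prop) hlip hbdd 0
  have hmono : StrictMonoOn g (Ici 0) := by
    refine strictMonoOn_of_deriv_pos (convex_Ici 0) hgc fun x hx => ?_
    rw [interior_Ici] at hx
    rw [(hg' x hx).deriv]
    exact add_pos_of_pos_of_nonneg (Real.exp_pos _)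
      (mul_nonneg (le_max_right _ _) (hWpos _).le)
  have hgnn : ∀ x, 0 < x → 0 ≤ g x := fun x hx => by
    have := hmono self_mem_Ici hx.le hx
    rw [hg0] at this
    exact this.le
  refine ⟨fun x => g x * Real.exp (-x / m), by simp [hg0], by fun_prop, fun x hx => ?_⟩
  have hexp : HasDerivAt (fun x : ℝ => Real.exp (-x / m)) (Real.exp (-x / m) * (-1 / m)) x :=
    ((hasDerivAt_neg x).div_const m).exp
  refine HasDerivAt.congr_deriv (f := fun x => g x * Real.exp (-x / m)) ((hg' x hx).mul hexp) ?_
  have h₂ : Real.exp (x / m) * Real.exp (-x / m) = 1 := by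
    rw [← Real.exp_add, neg_div, add_neg_cancel, Real.exp_zero]
  simp only [hv, max_eq_left (hgnn x hx)]
  linear_combination h₂

namespace SurplusModel

variable {P : SurplusModel} {m : ℝ}

theorem exists_isHJBSolution (hr : 0 < P.r) (hσ : 0 < P.σ) (hσ₁ : 0 < P.σ₁) (hlam : 0 < P.lam)
    (hρ : |P.ρ| < 1) (hμr : P.μ ≠ P.r) (hm : 0 < m) :
    ∃ V : ℝ → ℝ, P.IsHJBSolution (ProbabilityTheory.expMeasure (1 / m)) V := by
  have hA := P.residualVariance_pos hσ₁ hρ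
  have hR := P.halfSqSharpe_pos hσ hμr
  obtain ⟨h, hh0, hhc, hh'⟩ := exists_reduced_solution (k := P.hedgedPremium) hA hR hr hlam hm
  -- The `max` extends `w` continuously to `ℝ`, so `u` and `V` below are differentiable everywhere.
  set w : ℝ → ℝ := fun x => riccatiRoot P.residualVariance P.halfSqSharpe
    (P.hedgedPremium + P.r * max x 0 - P.lam * h (max x 0)) with hw
  have hwpos : ∀ x, 0 < w x := fun x => riccatiRoot_pos hA hR _
  have hwc : Continuous w := by
    have h₁ : Continuous fun x : ℝ => h (max x 0) :=
      hhc.comp_continuous (by fun_prop) fun x => le_max_right x 0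
    exact continuous_riccatiRoot.comp
      (((continuous_const.mul (by fun_prop)).const_add _).sub (h₁.const_mul _))
  set u : ℝ → ℝ := fun x => Real.exp (-∫ y in (0 : ℝ)..x, w y) with hu
  have hupos : ∀ x, 0 < u x := fun x => Real.exp_pos _
  have hu' : ∀ x, HasDerivAt u (u x * -w x) x := fun x =>
    (hwc.integral_hasStrictDerivAt 0 x).hasDerivAt.neg.exp
  have huc : Continuous u := continuous_iff_continuousAt.2 fun x => (hu' x).continuousAt
  set V : ℝ → ℝ := fun x => ∫ y in (0 : ℝ)..x, u y with hV
  have hV' : ∀ x, HasDerivAt V (u x) x := fun x => (huc.integral_hasStrictDerivAt 0 x).hasDerivAt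
  have hVc : Continuous V := continuous_iff_continuousAt.2 fun x => (hV' x).continuousAt
  have hdV : deriv V = u := funext fun x => (hV' x).deriv
  have hdu : deriv u = fun x => u x * -w x := funext fun x => (hu' x).deriv
  have hV0 : V 0 = 0 := by simp [hV]
  have hC2 : ContDiff ℝ 2 V := by
    have h₁ : ContDiff ℝ 1 u := by
      rw [contDiff_one_iff_deriv, hdu]
      exact ⟨fun x => (hu' x).differentiableAt, by fun_prop⟩
    have : ContDiff ℝ (1 + 1) V := by
      rw [contDiff_succ_iff_deriv, hdV]
      exact ⟨fun x => (hV' x).differentiableAt, by simp, h₁⟩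
    simpa [one_add_one_eq_two] using this
  have hneg : ∀ x, deriv (deriv V) x < 0 := fun x => by
    rw [hdV, hdu]
    exact mul_neg_of_pos_of_neg (hupos x) (neg_neg_of_pos (hwpos x))
  refine ⟨V, hC2.contDiffOn, hVc.continuousOn, fun x _ => hdV ▸ hupos x, fun x _ => hneg x, hV0,
    ?_, fun x hx => ?_⟩
  · rw [hdV]
    have h₁ := (huc.tendsto 0).mono_left (nhdsWithin_le_nhds (s := Ioi 0))
    simpa [hu] using h₁
  · rw [P.isLUB_generator_iff hσ _ (hneg x)]
    obtain ⟨E, hEc, hE0, hE', hEj⟩ := exists_primitive_jump hm hVc.continuousOn hV0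
      fun x _ => hV' x
    have hexp : ∀ y, HasDerivAt (fun x : ℝ => Real.exp (x / m)) (Real.exp (y / m) * (1 / m)) y :=
      fun y => ((hasDerivAt_id y).div_const m).exp
    -- Both sides vanish at `0` and have the same derivative on `(0, x)`. This identifies `h` with
    -- `M(V)/(λ V')`, so the quadratic becomes the HJB equation.
    have hEeq : E x = h x * u x * Real.exp (x / m) := by
      have hder : ∀ y ∈ Ioo 0 x,
          HasDerivAt (fun y => E y - h y * u y * Real.exp (y / m)) 0 y := by
        intro y hy
        have hy0 : 0 < y := hy.1
        refine HasDerivAt.congr_deriv (f := fun y => E y - h y * u y * Real.exp (y / m))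
          ((hE' y hy0).sub (((hh' y hy0).mul (hu' y)).mul (hexp y))) ?_
        simp only [hw, max_eq_left hy0.le, Pi.mul_apply]
        ring
      obtain ⟨c, hc, hslope⟩ := exists_hasDerivAt_eq_slope
        (fun y => E y - h y * u y * Real.exp (y / m)) (fun _ => 0) hx
        (by
          have h₁ := hEc.mono (Icc_subset_Ici_self : Icc 0 x ⊆ Ici 0)
          have h₂ := hhc.mono (Icc_subset_Ici_self : Icc 0 x ⊆ Ici 0)
          fun_prop) hder
      rw [eq_comm, div_eq_zero_iff, hE0, hh0] at hslope
      rcases hslope with h₁ | h₁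
      · linarith
      · linarith
    have h₂ : Real.exp (-x / m) * Real.exp (x / m) = 1 := by
      rw [← Real.exp_add, neg_div, neg_add_cancel, Real.exp_zero]
    have hjump : P.jumpTerm (ProbabilityTheory.expMeasure (1 / m)) V x = P.lam * (h x * u x) := by
      rw [jumpTerm, hEj x hx, hEeq]
      linear_combination P.lam * h x * u x * h₂
    have hroot := riccatiRoot_eq hA hR
      (P.hedgedPremium + P.r * max x 0 - P.lam * h (max x 0))
    have hwx := (hwpos x).ne'
    have hux := (hupos x).ne'
    change P.residualVariance * w x ^ 2 - _ * w x - _ = 0 at hroot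
    rw [max_eq_left hx.le] at hroot
    rw [hjump, hdV, hdu]
    field_simp
    linear_combination -u x * hroot

end SurplusModel

theorem mainTheorem6 (P : SurplusModel) (m : ℝ)
    (hc : 0 < P.c) (hr : 0 < P.r) (hμ : 0 < P.μ) (hσ : 0 < P.σ) (hσ₁ : 0 < P.σ₁)
    (hlam : 0 < P.lam) (hρ : |P.ρ| < 1) (hμr : P.μ ≠ P.r) (hm : 0 < m) :
    (∃ V : ℝ → ℝ, P.IsHJBSolution (ProbabilityTheory.expMeasure (1 / m)) V) ∧
    ∀ V : ℝ → ℝ, P.IsHJBSolution (ProbabilityTheory.expMeasure (1 / m)) V →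
      -- the optimal investment is the unique maximizer in the HJB equation
      (∀ x, 0 < x → ∀ a : ℝ, a ≠ P.optimalInvestment V x →
        P.generator (ProbabilityTheory.expMeasure (1 / m)) a V x <
          P.generator (ProbabilityTheory.expMeasure (1 / m)) (P.optimalInvestment V x) V x) ∧
      -- finite limit
      Tendsto (P.optimalInvestment V) atTop (𝓝 (P.limitInvestment m)) ∧
      -- expansion up to `o(1/x)`
      (fun x => P.optimalInvestment V x - (P.limitInvestment m - P.rateCoeff m * (1 / x)))
        =o[atTop] (fun x : ℝ => 1 / x) ∧
      -- multiplicative form of the same expansion when the coefficient of `1/x` is nonzero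
      (P.lam ≠ P.r → ∃ ε : ℝ → ℝ, Tendsto ε atTop (𝓝 0) ∧
        ∀ x, 0 < x → P.optimalInvestment V x =
          P.limitInvestment m - P.rateCoeff m * (1 / x) * (1 + ε x)) := by
  refine ⟨SurplusModel.exists_isHJBSolution hr hσ hσ₁ hlam hρ hμr hm, fun V hV => ⟨?_, ?_, ?_, ?_⟩⟩
  · exact fun x hx a ha =>
      P.generator_lt_generator_optimalInvestment hσ _ (hV.deriv_deriv_neg x hx) ha
  · exact hV.tendsto_optimalInvestment hr hσ hσ₁ hlam hρ hμr hm
  · exact hV.isLittleO_optimalInvestment hr hσ hσ₁ hlam hρ hμr hm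
  · exact hV.exists_optimalInvestment_eq_mul hr hσ hσ₁ hlam hρ hμr hm
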